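/- For $n\ge 1$ let $S_n$ be the symmetric group on $\{1,\dots,n\}$, and write $\sigma\in S_n$ as the list $[\sigma(1),\dots,\sigma(n)]$. Let $\mathrm{des}(\sigma)$ be the number of indices $i\in\{1,\dots,n-1\}$ with $\sigma(i)>\sigma(i+1)$. A \emph{hook} is a list $[t_1,\dots,t_h]$ of distinct non-zero natural numbers with $h\ge 2$, $t_1>t_2$ and $t_2<t_3<\dots<t_h$. Every list of distinct non-zero natural numbers can be written in exactly one way as a concatenation $p\,\tau_1\cdots\tau_k$ ($k\ge 0$), where $p$ is a (possibly empty) increasing list and each $\tau_i$ is a hook; this is its hook factorization. For $\sigma\in S_n$ with hook factorization $p\,\tau_1\cdots\tau_k$ put $\mathrm{lec}(\sigma)=\sum_{i=1}^k|\mathrm{inv}(\tau_i)|$, where $\mathrm{inv}(\tau)$ is the set of pairs of positions $i<j$ of the list $\tau$ whose entries satisfy $\tau(i)>\tau(j)$. In $\mathbb{Q}[q][[t]]$ define \[ \mathcal{L}(q,t)=\sum_{n\ge1}\Bigl(\sum_{\sigma\in S_n}q^{\mathrm{lec}(\sigma)}\Bigr)\frac{t^n}{n!},\qquad \mathcal{E}(q,t)=\sum_{n\ge1}\Bigl(\sum_{\sigma\in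 S_n}q^{\mathrm{des}(\sigma)}\Bigr)\frac{t^n}{n!}. \] Then $\mathcal{L}(q,t)=\mathcal{E}(q,t)$. Consequently $\mathrm{lec}$ and $\mathrm{des}$ are equidistributed: for all $n$ and $k$, the number of $\sigma\in S_n$ with $\mathrm{lec}(\sigma)=k$ equals the number of $\sigma\in S_n$ with $\mathrm{des}(\sigma)=k$, i.e. $\mathrm{lec}$ is an Eulerian statistic. -/

import Mathlib

namespace LecDes

/-- The set of inversions of a list `[l₀, l₁, …]`: the pairs of positions `i < j` with `l_i > l_j`. -/
def inversions (l : List ℕ) : Finset (Fin l.length × Fin l.length) :=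
  Finset.univ.filter fun p => p.1 < p.2 ∧ l.get p.2 < l.get p.1

/-- A hook is a list `[t₁, …, t_h]` of distinct non-zero natural numbers with `h ≥ 2`, `t₁ > t₂`
and `t₂ < t₃ < ⋯ < t_h`. -/
def IsHook : List ℕ → Prop
  | t₁ :: t₂ :: ts =>
      (t₁ :: t₂ :: ts).Nodup ∧ (∀ x ∈ t₁ :: t₂ :: ts, x ≠ 0) ∧ t₂ < t₁ ∧
        (t₂ :: ts).Pairwise (· < ·)
  | _ => False

/-- `(p, [τ₁, …, τ_k])` is a hook factorization of `l`: `l` is the concatenation `p τ₁ ⋯ τ_k`,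
the list `p` is (possibly empty and) increasing, and every `τ_i` is a hook. -/
def IsHookFactorization (l : List ℕ) (F : List ℕ × List (List ℕ)) : Prop :=
  l = F.1 ++ F.2.flatten ∧ F.1.Pairwise (· < ·) ∧ ∀ τ ∈ F.2, IsHook τ

/-- Prepend a letter to a word `p τ₁ ⋯ τ_k` given by its hook factorization. -/
def consHook (a : ℕ) : List ℕ × List (List ℕ) → List ℕ × List (List ℕ)
  | ([], τs) => ([a], τs)
  | (b :: p, τs) => if a < b then (a :: b :: p, τs) else ([], (a :: b :: p) :: τs)

/-- The hook factorization of a list, read from right to left. That it is the unique hook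
factorization of a list of distinct non-zero numbers is `isHookFactorization_iff` below. -/
def hookFactorization (l : List ℕ) : List ℕ × List (List ℕ) :=
  l.foldr consHook ([], [])

theorem isHookFactorization_hookFactorization (l : List ℕ) (hl : l.Nodup) (h0 : ∀ x ∈ l, x ≠ 0) :
    IsHookFactorization l (hookFactorization l) := by
  induction l with
  | nil => simp [hookFactorization, IsHookFactorization]
  | cons a l ih =>
    obtain ⟨h1, h2, h3⟩ := ih hl.of_cons (fun x hx => h0 x (List.mem_cons_of_mem _ hx))
    change IsHookFactorization (a :: l) (consHook a (hookFactorization l))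
    generalize hookFactorization l = F at h1 h2 h3
    obtain ⟨p, τs⟩ := F
    dsimp only at h1 h2 h3
    subst h1
    cases p with
    | nil => exact ⟨rfl, List.pairwise_singleton _ a, h3⟩
    | cons b p =>
      simp only [consHook]
      split_ifs with hab
      · refine ⟨rfl, ?_, h3⟩
        refine List.pairwise_cons.2 ⟨fun x hx => ?_, h2⟩
        rcases List.mem_cons.1 hx with rfl | hx
        · exact hab
        · exact hab.trans ((List.pairwise_cons.1 h2).1 x hx)
      · refine ⟨by simp, by simp, ?_⟩
        intro τ hτ
        rcases List.mem_cons.1 hτ with rfl | hτ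
        · refine ⟨?_, ?_, ?_, h2⟩
          · exact hl.sublist (by simp)
          · intro x hx
            apply h0
            simp only [List.mem_cons, List.mem_append] at hx ⊢
            tauto
          · have : a ≠ b := by
              rintro rfl
              simp at hl
            omega
        · exact h3 τ hτ

theorem IsHookFactorization.eq_hookFactorization {l : List ℕ} {F : List ℕ × List (List ℕ)}
    (hF : IsHookFactorization l F) : hookFactorization l = F := by
  have inc : ∀ (p : List ℕ) (τs : List (List ℕ)), p.Pairwise (· < ·) →
      p.foldr consHook ([], τs) = (p, τs) := by
    intro p τs hp
    induction p with
    | nil => rfl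
    | cons a p ih =>
      rw [List.foldr_cons, ih hp.of_cons]
      cases p with
      | nil => rfl
      | cons b p =>
        have : a < b := (List.pairwise_cons.1 hp).1 b (by simp)
        simp [consHook, this]
  have hooks : ∀ τs : List (List ℕ), (∀ τ ∈ τs, IsHook τ) →
      τs.flatten.foldr consHook ([], []) = ([], τs) := by
    intro τs hτ
    induction τs with
    | nil => rfl
    | cons τ τs ih =>
      rw [List.flatten_cons, List.foldr_append, ih (fun x hx => hτ x (List.mem_cons_of_mem _ hx))]
      have h := hτ τ (by simp)
      match τ, h with
      | a :: b :: ts, h =>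
        obtain ⟨-, -, h1, h2⟩ := h
        rw [List.foldr_cons, inc _ _ h2]
        simp [consHook, h1.not_gt]
  obtain ⟨p, τs⟩ := F
  obtain ⟨rfl, h2, h3⟩ := hF
  rw [hookFactorization, List.foldr_append, hooks _ h3, inc _ _ h2]

/-- Existence and uniqueness of the hook factorization. -/
theorem isHookFactorization_iff (l : List ℕ) (hl : l.Nodup) (h0 : ∀ x ∈ l, x ≠ 0)
    (F : List ℕ × List (List ℕ)) : IsHookFactorization l F ↔ F = hookFactorization l :=
  ⟨fun h => h.eq_hookFactorization.symm,
    fun h => h ▸ isHookFactorization_hookFactorization l hl h0⟩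

/-- The one-line notation `[σ(1), …, σ(n)]` of `σ ∈ S_n`, with values in `{1, …, n}`. -/
def oneLine {n : ℕ} (σ : Equiv.Perm (Fin n)) : List ℕ :=
  List.ofFn fun i => (σ i : ℕ) + 1

/-- `lec σ` is the sum of the numbers of inversions of the hooks `τ₁, …, τ_k` in the hook
factorization `p τ₁ ⋯ τ_k` of `[σ(1), …, σ(n)]`. -/
def lec {n : ℕ} (σ : Equiv.Perm (Fin n)) : ℕ :=
  ((hookFactorization (oneLine σ)).2.map fun τ => (inversions τ).card).sum

/-- `des σ` is the number of descents of `σ`: positions `i` with `i + 1` also a position and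
`σ(i) > σ(i + 1)`. -/
def des {n : ℕ} (σ : Equiv.Perm (Fin n)) : ℕ :=
  (Finset.univ.filter fun i : Fin n => ∃ h : (i : ℕ) + 1 < n, σ ⟨(i : ℕ) + 1, h⟩ < σ i).card

/-- The exponential generating function `∑_{n ≥ 1} (∑_{σ ∈ S_n} q ^ stat σ) t ^ n / n!` of a
statistic on the symmetric groups, as an element of `ℚ[q]⟦t⟧`. -/
noncomputable def statEGF (stat : ∀ n : ℕ, Equiv.Perm (Fin n) → ℕ) : PowerSeries (Polynomial ℚ) :=
  PowerSeries.mk fun n =>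
    if n = 0 then 0
    else Polynomial.C ((n.factorial : ℚ)⁻¹) *
      ∑ σ : Equiv.Perm (Fin n), (Polynomial.X : Polynomial ℚ) ^ stat n σ

/-- The series `𝓛(q,t)` of the statistic `lec`. -/
noncomputable def lecEGF : PowerSeries (Polynomial ℚ) := statEGF fun _ σ => lec σ

/-- The series `𝓔(q,t)` of the statistic `des`. -/
noncomputable def desEGF : PowerSeries (Polynomial ℚ) := statEGF fun _ σ => des σ

end LecDes

/-!
Cut words in two and convolve weights accordingly. The identity `q = 1 + (q - 1)` at each descent
writes `q ^ des`, on nonempty words, as its own convolution with the weight `(q - 1) ^ (k - 1)` of a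
decreasing prefix of length `k`, while a word is either increasing or ends in a unique hook. Summing
over all arrangements of a finite set `s` turns both word identities into recurrences over the
subsets of `s`, namely `D = δ + r ⋆ D` and `L = 1 + L ⋆ h`, where `δ` is the indicator of `∅`, `1`
is constant, `r(B) = (q - 1) ^ (#B - 1)` and `h(B) = q + ⋯ + q ^ (#B - 1)` for `B ≠ ∅`, and
`r(∅) = h(∅) = 0`. The binomial theorem gives `∑_{C ⊆ B} r(C) = 1 + q + ⋯ + q ^ (#B - 1)` for
`B ≠ ∅`, that is, `δ - h = 1 ⋆ (δ - r)`. Hence `D` satisfies the recurrence of `L`, which determines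
its solution by induction on `s`.
-/

namespace LecDes

open Finset

section Arrangements

variable {α : Type*}

/-- The words that use each letter of the finite set `s` exactly once. -/
def arrangements (s : Finset α) : Finset (List α) :=
  ⟨s.val.lists, Multiset.lists_nodup_finset s⟩

theorem mem_arrangements [DecidableEq α] {s : Finset α} {l : List α} :
    l ∈ arrangements s ↔ l.Nodup ∧ l.toFinset = s := by
  rw [arrangements, Finset.mem_mk, Multiset.mem_lists_iff]
  refine ⟨fun h => ?_, fun ⟨hl, hs⟩ => ?_⟩
  · have hl : l.Nodup := by
      rw [← Multiset.coe_nodup, ← Multiset.quot_mk_to_coe, ← h]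
      exact s.nodup
    exact ⟨hl, Finset.val_injective (by rw [List.toFinset_val, hl.dedup, h]; rfl)⟩
  · rw [← hs, List.toFinset_val, hl.dedup]; rfl

theorem card_arrangements (s : Finset α) : #(arrangements s) = (#s).factorial := by
  rw [arrangements, Finset.card_mk, ← Finset.coe_toList, Multiset.lists_coe, Multiset.coe_card,
    List.length_permutations, Finset.length_toList]

/-- The sum of the weight `w` over all arrangements of `s`: the generating function of `w` at the
set `s`. -/
def arrangementSum {M : Type*} [AddCommMonoid M] (w : List α → M) (s : Finset α) : M :=
  ∑ l ∈ arrangements s, w l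

theorem arrangementSum_congr [DecidableEq α] {M : Type*} [AddCommMonoid M] {v w : List α → M}
    {s : Finset α} (h : ∀ l : List α, l.Nodup → l.toFinset = s → v l = w l) :
    arrangementSum v s = arrangementSum w s :=
  Finset.sum_congr rfl fun l hl => (mem_arrangements.1 hl).elim (h l)

theorem arrangementSum_add {M : Type*} [AddCommMonoid M] (v w : List α → M) (s : Finset α) :
    arrangementSum (fun l => v l + w l) s = arrangementSum v s + arrangementSum w s :=
  Finset.sum_add_distrib

theorem arrangementSum_empty {M : Type*} [AddCommMonoid M] (w : List α → M) :
    arrangementSum w ∅ = w [] := by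
  classical
  have h : arrangements (∅ : Finset α) = {[]} := by
    ext l
    rw [mem_arrangements, List.toFinset_eq_empty_iff, Finset.mem_singleton, and_iff_right_of_imp]
    rintro rfl
    exact List.nodup_nil
  rw [arrangementSum, h, Finset.sum_singleton]

theorem arrangementSum_ite_eq_nil [DecidableEq α] {M : Type*} [AddCommMonoid M] (c : M)
    (s : Finset α) :
    arrangementSum (fun l => if l = [] then c else 0) s = if s = ∅ then c else 0 := by
  rcases eq_or_ne s ∅ with rfl | hs
  · rw [arrangementSum_empty, if_pos rfl, if_pos rfl]
  · rw [if_neg hs]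
    refine Finset.sum_eq_zero fun l hl => if_neg ?_
    rintro rfl
    exact hs (mem_arrangements.1 hl).2.symm

theorem arrangementSum_eq_sum_erase [DecidableEq α] {M : Type*} [AddCommMonoid M]
    (w : List α → M) {s : Finset α} (hs : s.Nonempty) :
    arrangementSum w s = ∑ a ∈ s, arrangementSum (fun l => w (a :: l)) (s.erase a) := by
  simp only [arrangementSum]
  rw [Finset.sum_sigma']
  symm
  refine Finset.sum_nbij (fun x => x.1 :: x.2) ?_ ?_ ?_ fun _ _ => rfl
  · rintro ⟨a, l⟩ hal
    obtain ⟨ha, hl⟩ := Finset.mem_sigma.1 hal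
    obtain ⟨hnd, htf⟩ := mem_arrangements.1 hl
    dsimp only at ha htf hnd
    refine mem_arrangements.2 ⟨List.nodup_cons.2 ⟨fun h => ?_, hnd⟩, ?_⟩
    · simpa [htf] using List.mem_toFinset.2 h
    · rw [List.toFinset_cons, htf, Finset.insert_erase ha]
  · rintro ⟨a, l⟩ - ⟨b, m⟩ - h
    obtain ⟨rfl, rfl⟩ := List.cons.inj h
    rfl
  · intro l hl
    obtain ⟨hnd, rfl⟩ := mem_arrangements.1 hl
    cases l with
    | nil => simp at hs
    | cons a l =>
      obtain ⟨ha, hl⟩ := List.nodup_cons.1 hnd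
      refine ⟨⟨a, l⟩, Finset.mem_sigma.2 ⟨by simp, mem_arrangements.2 ⟨hl, ?_⟩⟩, rfl⟩
      rw [List.toFinset_cons, Finset.erase_insert (mt List.mem_toFinset.1 ha)]

theorem arrangementSum_ite_of_forall_eq {M : Type*} [AddCommMonoid M] {P : List α → Prop}
    [DecidablePred P] (w : List α → M) {s : Finset α} {l₀ : List α} (hl₀ : l₀ ∈ arrangements s)
    (h₀ : P l₀) (huniq : ∀ l ∈ arrangements s, P l → l = l₀) :
    arrangementSum (fun l => if P l then w l else 0) s = w l₀ := by
  rw [arrangementSum, Finset.sum_eq_single_of_mem l₀ hl₀, if_pos h₀]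
  exact fun l hl hne => if_neg (mt (huniq l hl) hne)

theorem arrangementSum_sortedLT {α M : Type*} [LinearOrder α] [AddCommMonoid M] (w : List α → M)
    (s : Finset α) :
    arrangementSum (fun l => if l.SortedLT then w l else 0) s = w s.sort := by
  refine arrangementSum_ite_of_forall_eq w
    (mem_arrangements.2 ⟨s.sort_nodup _, s.sort_toFinset _⟩) s.sortedLT_sort fun l hl hlt => ?_
  obtain ⟨hnd, rfl⟩ := mem_arrangements.1 hl
  exact ((List.toFinset_sort _ hnd).2 hlt.sortedLE.pairwise).symm

theorem arrangementSum_sortedGT {α M : Type*} [LinearOrder α] [AddCommMonoid M] (w : List α → M)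
    (s : Finset α) :
    arrangementSum (fun l => if l.SortedGT then w l else 0) s = w (s.sort (· ≥ ·)) := by
  refine arrangementSum_ite_of_forall_eq w
    (mem_arrangements.2 ⟨s.sort_nodup _, s.sort_toFinset _⟩) s.sortedGT_sort fun l hl hgt => ?_
  obtain ⟨hnd, rfl⟩ := mem_arrangements.1 hl
  exact ((List.toFinset_sort _ hnd).2 hgt.sortedGE.pairwise).symm

end Arrangements

section Cuts

variable {α R : Type*}

/-- The convolution of two weights on words: the sum of `f u * g v` over all ways of cutting a word
into a prefix `u` and a suffix `v`. -/
def cutConv [NonUnitalNonAssocSemiring R] (f g : List α → R) (l : List α) : R :=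
  ∑ h ∈ range (l.length + 1), f (l.take h) * g (l.drop h)

theorem cutConv_nil [NonUnitalNonAssocSemiring R] (f g : List α → R) :
    cutConv f g [] = f [] * g [] := by
  simp [cutConv]

theorem cutConv_cons [NonUnitalNonAssocSemiring R] (f g : List α → R) (a : α) (l : List α) :
    cutConv f g (a :: l) = f [] * g (a :: l) + cutConv (fun u => f (a :: u)) g l := by
  rw [cutConv, List.length_cons, Finset.sum_range_succ', add_comm]
  rfl

theorem arrangementSum_cutConv [DecidableEq α] [NonUnitalNonAssocSemiring R] (f g : List α → R)
    (s : Finset α) :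
    arrangementSum (cutConv f g) s =
      ∑ B ∈ s.powerset, arrangementSum f B * arrangementSum g (s \ B) := by
  simp_rw [arrangementSum, cutConv, Finset.sum_mul_sum, ← Finset.sum_product']
  rw [Finset.sum_sigma', Finset.sum_sigma']
  refine Finset.sum_bij'
    (fun x _ => ⟨(x.1.take x.2).toFinset, (x.1.take x.2, x.1.drop x.2)⟩)
    (fun y _ => ⟨y.2.1 ++ y.2.2, y.2.1.length⟩) ?_ ?_ ?_ ?_ fun _ _ => rfl
  · rintro ⟨l, h⟩ hx
    simp only [Finset.mem_sigma, mem_arrangements] at hx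
    obtain ⟨⟨hl, rfl⟩, -⟩ := hx
    have hdisj : Disjoint (l.take h).toFinset (l.drop h).toFinset :=
      List.disjoint_toFinset_iff_disjoint.2 (List.disjoint_take_drop hl le_rfl)
    have hunion : l.toFinset = (l.take h).toFinset ∪ (l.drop h).toFinset := by
      rw [← List.toFinset_append, List.take_append_drop]
    simp only [Finset.mem_sigma, Finset.mem_powerset, Finset.mem_product, mem_arrangements]
    refine ⟨hunion ▸ Finset.subset_union_left, ⟨hl.sublist (List.take_sublist _ _), trivial⟩,
      hl.sublist (List.drop_sublist _ _), ?_⟩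
    rw [hunion, Finset.union_sdiff_cancel_left hdisj]
  · rintro ⟨B, u, v⟩ hy
    simp only [Finset.mem_sigma, Finset.mem_powerset, Finset.mem_product, mem_arrangements] at hy
    obtain ⟨hB, ⟨hu, rfl⟩, hv, hvs⟩ := hy
    have hdisj : u.Disjoint v :=
      List.disjoint_toFinset_iff_disjoint.1 (hvs ▸ Finset.disjoint_sdiff)
    simp only [Finset.mem_sigma, Finset.mem_range, mem_arrangements, List.length_append]
    refine ⟨⟨List.nodup_append'.2 ⟨hu, hv, hdisj⟩, ?_⟩, by omega⟩
    rw [List.toFinset_append, hvs, Finset.union_sdiff_of_subset hB]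
  · rintro ⟨l, h⟩ hx
    simp only [Finset.mem_sigma, Finset.mem_range] at hx
    simp [Nat.le_of_lt_succ hx.2]
  · rintro ⟨B, u, v⟩ hy
    simp only [Finset.mem_sigma, Finset.mem_product, mem_arrangements] at hy
    obtain ⟨-, ⟨-, rfl⟩, -⟩ := hy
    simp

end Cuts

section Descents

variable {α R : Type*} [LinearOrder α] [CommRing R]

/-- The number of descents of a word, read off from its consecutive pairs of letters. -/
def listDes : List α → ℕ
  | [] => 0
  | [_] => 0
  | a :: b :: l => (if b < a then 1 else 0) + listDes (b :: l)

theorem card_descents_eq_listDes_ofFn {n : ℕ} (f : Fin n → α) :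
    #{i : Fin n | ∃ h : (i : ℕ) + 1 < n, f ⟨(i : ℕ) + 1, h⟩ < f i} = listDes (List.ofFn f) := by
  induction n with
  | zero => simp [listDes]
  | succ n ih =>
    cases n with
    | zero =>
      rw [List.ofFn_succ, List.ofFn_zero, listDes, Finset.card_eq_zero]
      exact Finset.filter_false_of_mem fun i _ ⟨h, _⟩ => by omega
    | succ n =>
      rw [Fin.card_filter_univ_succ', List.ofFn_succ, List.ofFn_succ, listDes,
        ← List.ofFn_succ (f := fun i => f i.succ), ← ih]
      simp [Fin.succ]

/-- The weight `(q - 1) ^ (n - 1)` of a decreasing word of length `n ≥ 1`. The empty word has weight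
`0`, so that a convolution with this weight only sees nonempty decreasing prefixes. -/
def decreasingCoeff (q : R) : ℕ → R
  | 0 => 0
  | n + 1 => (q - 1) ^ n

/-- The weight on words that is `decreasingCoeff` of the length on decreasing words and `0` on all
others. -/
def decreasingWeight (q : R) (l : List α) : R :=
  if l.SortedGT then decreasingCoeff q l.length else 0

theorem arrangementSum_decreasingWeight (q : R) (s : Finset α) :
    arrangementSum (decreasingWeight q) s = decreasingCoeff q #s := by
  rw [← Finset.length_sort (s := s) (· ≥ ·)]
  exact arrangementSum_sortedGT (fun l => decreasingCoeff q l.length) s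

theorem decreasingWeight_singleton (q : R) (a : α) : decreasingWeight q [a] = 1 := by
  simp [decreasingWeight, decreasingCoeff, List.sortedGT_iff_isChain]

theorem decreasingWeight_cons_cons (q : R) (a b : α) (l : List α) :
    decreasingWeight q (a :: b :: l) =
      if b < a then (q - 1) * decreasingWeight q (b :: l) else 0 := by
  simp only [decreasingWeight, List.sortedGT_iff_isChain, List.isChain_cons_cons, gt_iff_lt,
    decreasingCoeff, List.length_cons, pow_succ']
  split_ifs <;> simp_all

theorem pow_listDes_eq (q : R) (l : List α) :
    q ^ listDes l =
      (if l = [] then 1 else 0) + cutConv (decreasingWeight q) (fun v => q ^ listDes v) l := by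
  induction l with
  | nil => simp [cutConv_nil, decreasingWeight, decreasingCoeff, listDes]
  | cons a l ih =>
    have h_nil : decreasingWeight q ([] : List α) = 0 := by
      simp [decreasingWeight, decreasingCoeff]
    cases l with
    | nil => simp [cutConv_cons, cutConv_nil, h_nil, decreasingWeight_singleton, listDes]
    | cons b l =>
      rw [cutConv_cons, h_nil, if_neg (List.cons_ne_nil _ _)] at ih
      rw [cutConv_cons, cutConv_cons, h_nil, decreasingWeight_singleton, listDes,
        if_neg (List.cons_ne_nil _ _)]
      simp only [decreasingWeight_cons_cons]
      by_cases hba : b < a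
      · have h_scale : cutConv (fun u => (q - 1) * decreasingWeight q (b :: u))
            (fun v => q ^ listDes v) l =
            (q - 1) *
              cutConv (fun u => decreasingWeight q (b :: u)) (fun v => q ^ listDes v) l := by
          simp only [cutConv, Finset.mul_sum, mul_assoc]
        simp only [hba, if_true, h_scale, pow_add]
        linear_combination (q - 1) * ih
      · simp [hba, cutConv]

theorem arrangementSum_pow_listDes (q : R) (s : Finset α) :
    arrangementSum (fun l => q ^ listDes l) s = (if s = ∅ then 1 else 0) +
      ∑ B ∈ s.powerset, decreasingCoeff q #B * arrangementSum (fun l => q ^ listDes l) (s \ B) := by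
  simp_rw [← arrangementSum_decreasingWeight, ← arrangementSum_cutConv]
  rw [← arrangementSum_ite_eq_nil, ← arrangementSum_add]
  exact arrangementSum_congr fun l _ _ => pow_listDes_eq q l

end Descents

section SetRecurrences

variable {α R : Type*} [DecidableEq α]

theorem sum_powerset_powerset_sdiff {M : Type*} [AddCommMonoid M] (s : Finset α)
    (g : Finset α → Finset α → M) :
    ∑ B ∈ s.powerset, ∑ C ∈ (s \ B).powerset, g B C =
      ∑ T ∈ s.powerset, ∑ C ∈ T.powerset, g (T \ C) C := by
  rw [Finset.sum_sigma', Finset.sum_sigma']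
  refine Finset.sum_bij' (fun x _ => ⟨x.1 ∪ x.2, x.2⟩) (fun x _ => ⟨x.1 \ x.2, x.2⟩) ?_ ?_ ?_ ?_ ?_
  all_goals
    rintro ⟨B, C⟩ h
    simp only [Finset.mem_sigma, Finset.mem_powerset, Finset.subset_sdiff] at h ⊢
  · exact ⟨Finset.union_subset h.1 h.2.1, Finset.subset_union_right⟩
  · exact ⟨Finset.sdiff_subset.trans h.1, h.2.trans h.1, Finset.disjoint_sdiff⟩
  · rw [Finset.union_sdiff_cancel_right h.2.2.symm]
  · rw [Finset.sdiff_union_of_subset h.2]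
  · rw [Finset.union_sdiff_cancel_right h.2.2.symm]

theorem eq_of_sum_powerset_recurrence [NonUnitalNonAssocSemiring R] {a c F G : Finset α → R}
    (hc : c ∅ = 0) {s : Finset α}
    (hF : ∀ t ⊆ s, F t = a t + ∑ B ∈ t.powerset, F B * c (t \ B))
    (hG : ∀ t ⊆ s, G t = a t + ∑ B ∈ t.powerset, G B * c (t \ B)) : F s = G s := by
  induction s using Finset.strongInduction with
  | H s ih =>
    rw [hF s subset_rfl, hG s subset_rfl]
    congr 1
    refine Finset.sum_congr rfl fun B hB => ?_
    rcases (Finset.mem_powerset.1 hB).eq_or_ssubset with rfl | hBs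
    · simp [hc]
    · rw [ih B hBs (fun t ht => hF t (ht.trans hBs.subset)) fun t ht => hG t (ht.trans hBs.subset)]

variable [CommRing R]

theorem sum_powerset_decreasingCoeff {α : Type*} (q : R) (s : Finset α) :
    ∑ C ∈ s.powerset, decreasingCoeff q #C = ∑ i ∈ range #s, q ^ i := by
  classical
  induction s using Finset.induction with
  | empty => simp [decreasingCoeff]
  | insert a s ha ih =>
    have h_insert : ∀ C ∈ s.powerset, decreasingCoeff q #(insert a C) = (q - 1) ^ #C := by
      intro C hC
      rw [Finset.card_insert_of_notMem fun h => ha (Finset.mem_powerset.1 hC h), decreasingCoeff]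
    have h_binom := Finset.sum_pow_mul_eq_add_pow (q - 1) 1 s
    simp only [one_pow, mul_one, sub_add_cancel] at h_binom
    rw [Finset.sum_powerset_insert ha, Finset.sum_congr rfl h_insert, h_binom, ih,
      Finset.card_insert_of_notMem ha, Finset.sum_range_succ]

theorem sum_pow_Ico_one_card (q : R) (s : Finset α) :
    ∑ i ∈ Ico 1 #s, q ^ i =
      ∑ C ∈ s.powerset, decreasingCoeff q #C + (if s = ∅ then 1 else 0) - 1 := by
  rw [sum_powerset_decreasingCoeff]
  rcases s.eq_empty_or_nonempty with rfl | hs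
  · simp
  · rw [if_neg hs.ne_empty, Finset.range_eq_Ico, Finset.sum_eq_sum_Ico_succ_bot hs.card_pos]
    simp

theorem eq_one_add_sum_of_decreasingCoeff_recurrence {q : R} {D : Finset α → R}
    (hD : ∀ s, D s = (if s = ∅ then 1 else 0) +
      ∑ B ∈ s.powerset, decreasingCoeff q #B * D (s \ B)) (s : Finset α) :
    D s = 1 + ∑ B ∈ s.powerset, D B * ∑ i ∈ Ico 1 #(s \ B), q ^ i := by
  have h_delta : ∑ B ∈ s.powerset, D B * (if s \ B = ∅ then 1 else 0) = D s := by
    rw [Finset.sum_eq_single_of_mem s (Finset.mem_powerset_self s)]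
    · simp
    · intro B hB hne
      have hsB : ¬ s ⊆ B := fun h => hne ((Finset.mem_powerset.1 hB).antisymm h)
      rw [if_neg (by rwa [Finset.sdiff_eq_empty_iff_subset]), mul_zero]
  have h_double : ∑ B ∈ s.powerset, D B * ∑ C ∈ (s \ B).powerset, decreasingCoeff q #C =
      ∑ T ∈ s.powerset, D T - 1 := by
    have h_one : ∑ T ∈ s.powerset, (if T = ∅ then (1 : R) else 0) = 1 := by simp
    simp_rw [Finset.mul_sum]
    rw [sum_powerset_powerset_sdiff s fun B C => D B * decreasingCoeff q #C, eq_sub_iff_add_eq']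
    nth_rw 1 [← h_one]
    rw [← Finset.sum_add_distrib]
    refine Finset.sum_congr rfl fun T _ => ?_
    rw [hD T]
    simp only [mul_comm]
  simp_rw [sum_pow_Ico_one_card, mul_sub, mul_add, mul_one, Finset.sum_sub_distrib,
    Finset.sum_add_distrib, h_delta, h_double]
  ring

end SetRecurrences

section Hooks

variable {R : Type*} [Semiring R]

/-- The statistic `lec` on words: the number of inversions inside the hooks of the hook
factorization. -/
def listLec (l : List ℕ) : ℕ :=
  ((hookFactorization l).2.map fun τ => #(inversions τ)).sum

theorem card_inversions_cons (a : ℕ) (l : List ℕ) :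
    #(inversions (a :: l)) = l.countP (· < a) + #(inversions l) := by
  have h_countP : l.countP (· < a) = ∑ j : Fin l.length, if l[j] < a then 1 else 0 := by
    induction l with
    | nil => rfl
    | cons b l ih =>
      simp only [List.countP_cons, ih, List.length_cons, Fin.sum_univ_succ, decide_eq_true_eq,
        add_comm]
      rfl
  simp only [inversions, Finset.card_filter, Fintype.sum_prod_type, List.length_cons,
    Fin.sum_univ_succ, h_countP, false_and, if_false, zero_add,
    Fin.succ_pos, true_and, Fin.not_lt_zero, Fin.succ_lt_succ_iff]
  rfl

theorem card_inversions_of_sortedLT {l : List ℕ} (hl : l.SortedLT) : #(inversions l) = 0 := by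
  refine Finset.card_eq_zero.2 (Finset.filter_false_of_mem fun p _ ⟨hlt, hinv⟩ => ?_)
  exact (hl.strictMono_get hlt).not_gt hinv

theorem foldr_consHook_append (u : List ℕ) (p : List ℕ) (τs σs : List (List ℕ)) :
    u.foldr consHook (p, τs ++ σs) =
      ((u.foldr consHook (p, τs)).1, (u.foldr consHook (p, τs)).2 ++ σs) := by
  induction u with
  | nil => rfl
  | cons a u ih =>
    rw [List.foldr_cons, List.foldr_cons, ih]
    rcases List.foldr consHook (p, τs) u with ⟨_ | ⟨b, p'⟩, τs'⟩
    · rfl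
    · simp only [consHook]
      split_ifs <;> rfl

theorem hookFactorization_append_hook (u : List ℕ) {v : List ℕ} (hv : IsHook v) :
    hookFactorization (u ++ v) = ((hookFactorization u).1, (hookFactorization u).2 ++ [v]) := by
  have h_hook : hookFactorization v = ([], [v]) :=
    IsHookFactorization.eq_hookFactorization ⟨by simp, by simp, by simpa using hv⟩
  rw [hookFactorization] at h_hook
  rw [hookFactorization, List.foldr_append, h_hook]
  exact foldr_consHook_append u [] [] [v]

theorem listLec_append_hook (u : List ℕ) {v : List ℕ} (hv : IsHook v) :
    listLec (u ++ v) = listLec u + #(inversions v) := by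
  simp [listLec, hookFactorization_append_hook u hv]

theorem hookFactorization_of_sortedLT {l : List ℕ} (hl : l.SortedLT) :
    hookFactorization l = (l, []) :=
  IsHookFactorization.eq_hookFactorization ⟨by simp, hl.pairwise, by simp⟩

theorem eq_of_append_hook_eq_append_hook {u u' v v' : List ℕ} (hv : IsHook v) (hv' : IsHook v')
    (h : u ++ v = u' ++ v') : v = v' := by
  have h_last := congrArg (fun l => (hookFactorization l).2.getLast?) h
  simpa [hookFactorization_append_hook, hv, hv'] using h_last

theorem exists_eq_append_hook {l : List ℕ} (hl : l.Nodup) (h0 : ∀ x ∈ l, x ≠ 0)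
    (hlt : ¬ l.SortedLT) : ∃ u v, l = u ++ v ∧ IsHook v := by
  obtain ⟨h_eq, h_inc, h_hooks⟩ := isHookFactorization_hookFactorization l hl h0
  rcases List.eq_nil_or_concat' (hookFactorization l).2 with hF | ⟨τs, v, hF⟩
  · rw [hF, List.flatten_nil, List.append_nil] at h_eq
    exact absurd (h_eq ▸ h_inc.sortedLT) hlt
  · rw [hF] at h_eq h_hooks
    exact ⟨(hookFactorization l).1 ++ τs.flatten, v, by simpa using h_eq, h_hooks v (by simp)⟩

theorem not_sortedLT_append_hook (u : List ℕ) {v : List ℕ} (hv : IsHook v) :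
    ¬ (u ++ v).SortedLT := by
  intro h
  have h_eq := (hookFactorization_of_sortedLT h).symm.trans (hookFactorization_append_hook u hv)
  simp at h_eq

open Classical in
/-- The weight `q ^ inv v` of a hook `v`, extended by zero to all words. -/
noncomputable def hookWeight (q : R) (v : List ℕ) : R :=
  if IsHook v then q ^ #(inversions v) else 0

theorem pow_listLec_eq (q : R) {l : List ℕ} (hl : l.Nodup) (h0 : ∀ x ∈ l, x ≠ 0) :
    q ^ listLec l =
      (if l.SortedLT then 1 else 0) + cutConv (fun u => q ^ listLec u) (hookWeight q) l := by
  by_cases hlt : l.SortedLT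
  · have h_no_hook : ∀ h, ¬ IsHook (l.drop h) := fun h hv =>
      not_sortedLT_append_hook (l.take h) hv (by rwa [List.take_append_drop])
    simp [hlt, cutConv, hookWeight, h_no_hook, listLec, hookFactorization_of_sortedLT]
  · obtain ⟨u, v, rfl, hv⟩ := exists_eq_append_hook hl h0 hlt
    rw [if_neg hlt, zero_add, cutConv, Finset.sum_eq_single_of_mem u.length (by simp)]
    · rw [List.take_left, List.drop_left, hookWeight, if_pos hv, listLec_append_hook u hv, pow_add]
    · intro h hh hne
      rw [hookWeight, if_neg, mul_zero]
      intro hv'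
      have h_len := congrArg List.length
        (eq_of_append_hook_eq_append_hook hv' hv (List.take_append_drop h (u ++ v)))
      rw [List.length_drop, List.length_append] at h_len
      rw [Finset.mem_range, List.length_append] at hh
      omega

theorem isHook_cons_iff {a : ℕ} {l : List ℕ} (hl : (a :: l).Nodup) (h0 : ∀ x ∈ a :: l, x ≠ 0) :
    IsHook (a :: l) ↔ l.SortedLT ∧ l.countP (· < a) ≠ 0 := by
  cases l with
  | nil => simp [IsHook]
  | cons b l =>
    rw [IsHook, List.sortedLT_iff_pairwise, ← Nat.pos_iff_ne_zero, List.countP_pos_iff]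
    refine ⟨fun ⟨_, _, hba, hinc⟩ => ⟨hinc, b, by simp [hba]⟩, fun ⟨hinc, x, hx, hxa⟩ => ?_⟩
    have hbx : b ≤ x := by
      rcases List.mem_cons.1 hx with rfl | hx
      · exact le_rfl
      · exact (List.rel_of_pairwise_cons hinc hx).le
    exact ⟨hl, h0, hbx.trans_lt (of_decide_eq_true hxa), hinc⟩

theorem hookWeight_cons (q : R) {a : ℕ} {l : List ℕ} (hl : (a :: l).Nodup)
    (h0 : ∀ x ∈ a :: l, x ≠ 0) :
    hookWeight q (a :: l) =
      if l.SortedLT then (if l.countP (· < a) = 0 then 0 else q ^ l.countP (· < a)) else 0 := by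
  rw [hookWeight, isHook_cons_iff hl h0, card_inversions_cons]
  by_cases hlt : l.SortedLT
  · simp only [hlt, true_and, if_true, ne_eq, ite_not, card_inversions_of_sortedLT hlt, add_zero]
  · simp [hlt]

theorem sum_card_filter_lt {α M : Type*} [LinearOrder α] [AddCommMonoid M] (g : ℕ → M)
    (s : Finset α) : ∑ a ∈ s, g #{x ∈ s | x < a} = ∑ i ∈ range #s, g i := by
  induction s using Finset.induction_on_max with
  | empty => simp
  | insert m s hm ih =>
    have hms : m ∉ s := fun h => (hm m h).false
    have h_max : {x ∈ insert m s | x < m} = s := by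
      rw [Finset.filter_insert, if_neg (lt_irrefl m), Finset.filter_true_of_mem hm]
    have h_lt : ∀ a ∈ s, {x ∈ insert m s | x < a} = {x ∈ s | x < a} := fun a ha => by
      rw [Finset.filter_insert, if_neg (hm a ha).not_gt]
    rw [Finset.sum_insert hms, h_max, Finset.sum_congr rfl fun a ha => by rw [h_lt a ha], ih,
      Finset.card_insert_of_notMem hms, Finset.sum_range_succ, add_comm]

theorem arrangementSum_hookWeight (q : R) {s : Finset ℕ} (hs : 0 ∉ s) :
    arrangementSum (hookWeight q) s = ∑ i ∈ Ico 1 #s, q ^ i := by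
  classical
  rcases s.eq_empty_or_nonempty with rfl | hne
  · simp [arrangementSum_empty, hookWeight, IsHook]
  let g : ℕ → R := fun i => if i = 0 then 0 else q ^ i
  have h_first : ∀ a ∈ s,
      arrangementSum (fun l => hookWeight q (a :: l)) (s.erase a) = g #{x ∈ s | x < a} := by
    intro a ha
    have h_count : (s.erase a).sort.countP (· < a) = #{x ∈ s | x < a} := by
      rw [← (Finset.sort_nodup _ _).card_eq_countP, Finset.sort_toFinset, Finset.filter_erase]
      simp
    rw [← h_count, ← arrangementSum_sortedLT (fun l => g (l.countP (· < a)))]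
    refine arrangementSum_congr fun l hl hls => hookWeight_cons q ?_ ?_
    · rw [List.nodup_cons, ← List.mem_toFinset, hls]
      exact ⟨Finset.notMem_erase a s, hl⟩
    · intro x hx
      rw [← List.mem_toFinset, List.toFinset_cons, hls, Finset.insert_erase ha] at hx
      exact ne_of_mem_of_not_mem hx hs
  rw [arrangementSum_eq_sum_erase _ hne, Finset.sum_congr rfl h_first, sum_card_filter_lt,
    Finset.range_eq_Ico, Finset.sum_eq_sum_Ico_succ_bot hne.card_pos]
  simp only [g, if_true, zero_add]
  exact Finset.sum_congr rfl fun i hi => if_neg (by have := Finset.mem_Ico.1 hi; omega)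

theorem arrangementSum_pow_listLec (q : R) {s : Finset ℕ} (hs : 0 ∉ s) :
    arrangementSum (fun l => q ^ listLec l) s = 1 +
      ∑ B ∈ s.powerset,
        arrangementSum (fun l => q ^ listLec l) B * ∑ i ∈ Ico 1 #(s \ B), q ^ i := by
  have h_hooks : ∀ B : Finset ℕ,
      ∑ i ∈ Ico 1 #(s \ B), q ^ i = arrangementSum (hookWeight q) (s \ B) :=
    fun B => (arrangementSum_hookWeight q (by simp [hs])).symm
  have h_inc : arrangementSum (fun l => if l.SortedLT then (1 : R) else 0) s = 1 :=
    arrangementSum_sortedLT (fun _ => 1) s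
  simp_rw [h_hooks, ← arrangementSum_cutConv]
  rw [← h_inc, ← arrangementSum_add]
  refine arrangementSum_congr fun l hl hls => pow_listLec_eq q hl fun x hx => ?_
  exact ne_of_mem_of_not_mem (hls ▸ List.mem_toFinset.2 hx) hs

theorem arrangementSum_pow_listLec_eq_listDes {R : Type*} [CommRing R] (q : R) {s : Finset ℕ}
    (hs : 0 ∉ s) :
    arrangementSum (fun l => q ^ listLec l) s = arrangementSum (fun l => q ^ listDes l) s :=
  eq_of_sum_powerset_recurrence (a := fun _ => 1) (c := fun t => ∑ i ∈ Ico 1 #t, q ^ i) (by simp)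
    (fun _ ht => arrangementSum_pow_listLec q fun h => hs (ht h))
    (fun t _ => eq_one_add_sum_of_decreasingCoeff_recurrence (arrangementSum_pow_listDes q) t)

end Hooks

section Permutations

theorem oneLine_injective {n : ℕ} : Function.Injective (oneLine (n := n)) := by
  intro σ τ h
  ext i
  have := congrFun (List.ofFn_injective h) i
  omega

theorem oneLine_mem_arrangements {n : ℕ} (σ : Equiv.Perm (Fin n)) :
    oneLine σ ∈ arrangements (Icc 1 n) := by
  refine mem_arrangements.2 ⟨List.nodup_ofFn.2 fun i j h => σ.injective (Fin.ext ?_), ?_⟩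
  · simpa using h
  · ext x
    simp only [oneLine, List.mem_toFinset, List.mem_ofFn, Finset.mem_Icc]
    constructor
    · rintro ⟨i, rfl⟩
      have := (σ i).isLt
      omega
    · rintro ⟨h1, hn⟩
      exact ⟨σ.symm ⟨x - 1, by omega⟩, by simp [h1]⟩

theorem image_oneLine (n : ℕ) :
    Finset.univ.image (oneLine (n := n)) = arrangements (Icc 1 n) := by
  refine Finset.eq_of_subset_of_card_le ?_ ?_
  · exact Finset.image_subset_iff.2 fun σ _ => oneLine_mem_arrangements σ
  · rw [card_arrangements, Finset.card_image_of_injective _ oneLine_injective, Finset.card_univ,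
      Fintype.card_perm, Fintype.card_fin, Nat.card_Icc, Nat.add_sub_cancel]

theorem sum_oneLine {M : Type*} [AddCommMonoid M] (n : ℕ) (w : List ℕ → M) :
    ∑ σ : Equiv.Perm (Fin n), w (oneLine σ) = arrangementSum w (Icc 1 n) := by
  rw [arrangementSum, ← image_oneLine, Finset.sum_image oneLine_injective.injOn]

theorem des_eq_listDes_oneLine {n : ℕ} (σ : Equiv.Perm (Fin n)) :
    des σ = listDes (oneLine σ) := by
  rw [oneLine, ← card_descents_eq_listDes_ofFn, des]
  simp

theorem sum_pow_lec_eq_sum_pow_des {R : Type*} [CommRing R] (q : R) (n : ℕ) :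
    ∑ σ : Equiv.Perm (Fin n), q ^ lec σ = ∑ σ : Equiv.Perm (Fin n), q ^ des σ := by
  simp_rw [des_eq_listDes_oneLine]
  rw [sum_oneLine n fun l => q ^ listDes l, ← arrangementSum_pow_listLec_eq_listDes q (by simp),
    ← sum_oneLine]
  rfl

theorem coeff_sum_X_pow {ι R : Type*} [Semiring R] (s : Finset ι) (f : ι → ℕ) (k : ℕ) :
    (∑ i ∈ s, (Polynomial.X : Polynomial R) ^ f i).coeff k = #{i ∈ s | f i = k} := by
  simp [Polynomial.finsetSum_coeff, Polynomial.coeff_X_pow, Finset.sum_boole, eq_comm]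

end Permutations

end LecDes

theorem mainTheorem4 :
    LecDes.lecEGF = LecDes.desEGF ∧
      ∀ n k : ℕ,
        (Finset.univ.filter fun σ : Equiv.Perm (Fin n) => LecDes.lec σ = k).card =
          (Finset.univ.filter fun σ : Equiv.Perm (Fin n) => LecDes.des σ = k).card := by
  have h_sum (n : ℕ) := LecDes.sum_pow_lec_eq_sum_pow_des (Polynomial.X : Polynomial ℚ) n
  constructor
  · simp only [LecDes.lecEGF, LecDes.desEGF, LecDes.statEGF, h_sum]
  · intro n k
    have h_coeff := congrArg (fun p => Polynomial.coeff p k) (h_sum n)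
    simp only [LecDes.coeff_sum_X_pow] at h_coeff
    exact_mod_cast h_coeff
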